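/- **Setting.** A connected simple graph has $n$ buses and $m\ge 1$ lines; each line $\ell$ carries an arbitrary fixed orientation and a capacity $M_\ell>0$. The real susceptances satisfy $\beta_{i,j}=\beta_{j,i}$, with $\beta_{i,j}=0$ if no line joins $i$ and $j$. Let $L\in\mathbb R^{n\times n}$ be the weighted Laplacian, $L_{i,j}=-\beta_{i,j}$ for $i\ne j$ and $L_{i,i}=\sum_{k\neq i}\beta_{i,k}$, and let $L^+$ be its Moore–Penrose pseudo-inverse. Let $B\in\mathbb R^{m\times n}$ be the weighted incidence matrix: for a line $\ell=(i,j)$, $B_{\ell,i}=\beta_{i,j}$, $B_{\ell,j}=-\beta_{i,j}$, and all other entries of row $\ell$ are $0$. Let $D=\mathrm{diag}(M_1^{-1},\dots,M_m^{-1})$, $C=DBL^+$, and $S=\binom{I_{n-1}}{-\mathbf 1^T}\in\mathbb R^{n\times(n-1)}$. Let $\Sigma\in\mathbb R^{(n-1)\times(n-1)}$ be positive semidefinite, let $\sqrt\Sigma$ be any matrix with $\sqrt\Sigma\sqrt\Sigma^{T}=\Sigma$ (for example a Cholesky factor), and let $X$ be a standard Gaussian vector in $\mathbb R^{n-1}$.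 For $\mu\in\mathbb R^{n-1}$ the power injections are $p=S(\sqrt\Sigma X+\mu)$, the line power flows are $\widetilde f=BL^+p$, and the normalized flows are $f=Cp$, that is, $f_\ell=\widetilde f_\ell/M_\ell$. Write $V=CS\sqrt\Sigma$, $\nu=CS\mu$, $\sigma_i=\bigl(\sum_{j=1}^{n-1} V_{i,j}^2\bigr)^{1/2}$, $\mathcal L=\{\exists\,\ell:\ |\widetilde f_\ell|\ge M_\ell\}$, and $$r(\mu)=\mathbb E\max_i|f_i|,\qquad r^\star(\mu)=\inf_{s>0}\Bigl\{\frac{\log(2m)}{s}+\max_i\Bigl(\frac{\sigma_i^2}{2}s+|\nu_i|\Bigr)\Bigr\}.$$ For $q\in(0,1)$ define the following subsets of $\mathbb R^{n-1}$: $$\mathcal R^{\mathrm{up}}_q=\Bigl\{\mu:\max_i|\nu_i|\le 1-\max_i\sigma_i\bigl(\sqrt{2\log q^{-1}}+\sqrt{2\log(2m)}\bigr)\Bigr\},\qquad \mathcal R^{\star}_q=\Bigl\{\mu: r^\star(\mu)\le 1-\max_i\sigma_i\sqrt{2\log q^{-1}}\Bigr\},$$ $$\mathcal R^{\mathrm{c.i.}}_q=\Bigl\{\mu: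 r(\mu)\le 1-\max_i\sigma_i\sqrt{2\log q^{-1}}\Bigr\},\qquad \mathcal R^{\mathrm{true}}_q=\{\mu:\mathbb P(\mathcal L)\le q\}.$$ **Theorem (inclusions among capacity regions).** Let $q\in(0,1)$. For every $\mu$ the random variable $\max_i|f_i|$ is integrable, so $r(\mu)$ is well defined. Moreover, $$\mathcal R^{\mathrm{up}}_q\subseteq\mathcal R^{\star}_q\subseteq\mathcal R^{\mathrm{c.i.}}_q,\qquad \mathcal R^{\mathrm{c.i.}}_q\cap\{\mu:r(\mu)<1\}\subseteq\mathcal R^{\mathrm{true}}_q .$$ If $\max_i\sigma_i>0$, then $\mathcal R^{\mathrm{c.i.}}_q\subseteq\mathcal R^{\mathrm{true}}_q$ without further restriction, and $$\mathcal R^{\mathrm{c.i.}}_q=\Bigl\{\mu: r(\mu)<1,\ \exp\Bigl(-\frac{(1-r(\mu))^2}{2\max_i\sigma_i^2}\Bigr)\le q\Bigr\}.$$ -/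

import Mathlib

open MeasureTheory ProbabilityTheory Matrix

noncomputable section

/-- `P` is the Moore-Penrose pseudo-inverse of the real matrix `A`
(the four Penrose conditions). -/
structure IsMoorePenrose {a b : Type*} [Fintype a] [Fintype b]
    (A : Matrix a b ℝ) (P : Matrix b a ℝ) : Prop where
  mul_mul_self : A * P * A = A
  self_mul_mul : P * A * P = P
  transpose_left : (A * P)ᵀ = A * P
  transpose_right : (P * A)ᵀ = P * A

/-- The Moore-Penrose pseudo-inverse is unique. -/
theorem IsMoorePenrose.unique {a b : Type*} [Fintype a] [Fintype b]
    {A : Matrix a b ℝ} {P Q : Matrix b a ℝ}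
    (hP : IsMoorePenrose A P) (hQ : IsMoorePenrose A Q) : P = Q := by
  have h1 : A * P = A * Q := by
    calc A * P = (A * P)ᵀ := hP.transpose_left.symm
      _ = ((A * Q) * (A * P))ᵀ := by
          rw [← Matrix.mul_assoc (A * Q), hQ.mul_mul_self]
      _ = (A * P) * (A * Q) := by
          rw [Matrix.transpose_mul, hP.transpose_left, hQ.transpose_left]
      _ = A * Q := by rw [← Matrix.mul_assoc (A * P), hP.mul_mul_self]
  have h2 : P * A = Q * A := by
    calc P * A = (P * A)ᵀ := hP.transpose_right.symm
      _ = ((P * A) * (Q * A))ᵀ := by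
          rw [Matrix.mul_assoc P, ← Matrix.mul_assoc A, hQ.mul_mul_self]
      _ = (Q * A) * (P * A) := by
          rw [Matrix.transpose_mul, hP.transpose_right, hQ.transpose_right]
      _ = Q * A := by
          rw [Matrix.mul_assoc Q, ← Matrix.mul_assoc A, hP.mul_mul_self]
  calc P = P * A * P := hP.self_mul_mul.symm
    _ = Q * A * Q := by rw [h2, Matrix.mul_assoc, h1, ← Matrix.mul_assoc]
    _ = Q := hQ.self_mul_mul

/-- Every real symmetric matrix has a Moore-Penrose pseudo-inverse. -/
theorem exists_isMoorePenrose {a : Type*} [Fintype a] [DecidableEq a]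
    (A : Matrix a a ℝ) (hA : A.IsSymm) : ∃ P, IsMoorePenrose A P := by
  have hH : A.IsHermitian := by
    rw [Matrix.IsHermitian, Matrix.conjTranspose_eq_transpose_of_trivial]; exact hA
  obtain ⟨U, d, hU, hAd⟩ : ∃ (U : Matrix a a ℝ) (d : a → ℝ),
      Uᵀ * U = 1 ∧ A = U * diagonal d * Uᵀ := by
    refine ⟨hH.eigenvectorUnitary, hH.eigenvalues, ?_, ?_⟩
    · have := Unitary.coe_star_mul_self hH.eigenvectorUnitary
      rwa [Matrix.star_eq_conjTranspose, Matrix.conjTranspose_eq_transpose_of_trivial] at this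
    · have := hH.spectral_theorem
      rw [Unitary.conjStarAlgAut_apply, Matrix.star_eq_conjTranspose,
        Matrix.conjTranspose_eq_transpose_of_trivial] at this
      simpa [Function.comp_def] using this
  have key : ∀ x y : a → ℝ, (U * diagonal x * Uᵀ) * (U * diagonal y * Uᵀ)
      = U * diagonal (fun i => x i * y i) * Uᵀ := by
    intro x y
    calc (U * diagonal x * Uᵀ) * (U * diagonal y * Uᵀ)
        = U * diagonal x * (Uᵀ * U) * diagonal y * Uᵀ := by simp only [Matrix.mul_assoc]
      _ = _ := by rw [hU, Matrix.mul_one, Matrix.mul_assoc U, Matrix.diagonal_mul_diagonal]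
  have ht : ∀ x : a → ℝ, (U * diagonal x * Uᵀ)ᵀ = U * diagonal x * Uᵀ := by
    intro x
    simp [Matrix.transpose_mul, Matrix.mul_assoc]
  refine ⟨U * diagonal (fun i => (d i)⁻¹) * Uᵀ, ?_, ?_, ?_, ?_⟩
  · rw [hAd, key, key]; congr 3; ext i; exact mul_inv_mul_cancel (d i)
  · rw [hAd, key, key]; congr 3; ext i; simpa using mul_inv_mul_cancel (d i)⁻¹
  · rw [hAd, key, ht]
  · rw [hAd, key, ht]

/-- A transmission network with `k + 1` buses, the last of which is the slack bus, and `m` lines.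
Line `ℓ` is oriented from `src ℓ` to `dst ℓ` (an arbitrary but fixed orientation); the underlying
graph is simple and connected, `β` holds the susceptances, and `cap` the line capacities.
No sign condition is imposed on the susceptances. -/
structure PowerGrid (k m : ℕ) where
  src : Fin m → Fin (k + 1)
  dst : Fin m → Fin (k + 1)
  src_ne_dst : ∀ ℓ, src ℓ ≠ dst ℓ
  line_injective : Function.Injective (fun ℓ => s(src ℓ, dst ℓ))
  connected : (SimpleGraph.fromEdgeSet (Set.range (fun ℓ => s(src ℓ, dst ℓ)))).Connected
  β : Fin (k + 1) → Fin (k + 1) → ℝ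
  β_symm : ∀ i j, β i j = β j i
  β_eq_zero : ∀ i j, (∀ ℓ, s(src ℓ, dst ℓ) ≠ s(i, j)) → β i j = 0
  cap : Fin m → ℝ
  cap_pos : ∀ ℓ, 0 < cap ℓ

namespace PowerGrid

variable {k m : ℕ} (G : PowerGrid k m)

/-- The weighted Laplacian matrix `L`. -/
def lap : Matrix (Fin (k + 1)) (Fin (k + 1)) ℝ :=
  Matrix.of fun i j => if i = j then ∑ l ∈ Finset.univ.erase i, G.β i l else -G.β i j

theorem lap_isSymm : G.lap.IsSymm := by
  ext i j
  by_cases h : i = j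
  · subst h; rfl
  · simp [lap, h, Ne.symm h, G.β_symm i j]

/-- The Moore-Penrose pseudo-inverse `L⁺` of the weighted Laplacian. -/
def lapPinv : Matrix (Fin (k + 1)) (Fin (k + 1)) ℝ :=
  Classical.choose (exists_isMoorePenrose G.lap G.lap_isSymm)

theorem lapPinv_isMoorePenrose : IsMoorePenrose G.lap G.lapPinv :=
  Classical.choose_spec (exists_isMoorePenrose G.lap G.lap_isSymm)

/-- The weighted edge-vertex incidence matrix `B`. -/
def inc : Matrix (Fin m) (Fin (k + 1)) ℝ :=
  Matrix.of fun ℓ i =>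
    if i = G.src ℓ then G.β (G.src ℓ) (G.dst ℓ)
    else if i = G.dst ℓ then -G.β (G.src ℓ) (G.dst ℓ)
    else 0

/-- The matrix `C = D B L⁺`, where `D` is the diagonal matrix of the inverse line capacities. -/
def matC : Matrix (Fin m) (Fin (k + 1)) ℝ :=
  Matrix.diagonal (fun ℓ => (G.cap ℓ)⁻¹) * G.inc * G.lapPinv

end PowerGrid

/-- The matrix `S` that completes the injections at the first `k` buses to a zero-sum vector:
an identity block with a last row of entries `-1`. -/
def slackMatrix (k : ℕ) : Matrix (Fin (k + 1)) (Fin k) ℝ :=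
  Matrix.of fun i j => if i = Fin.last k then -1 else if i = j.castSucc then 1 else 0

namespace PowerGrid

variable {k m : ℕ} (G : PowerGrid k m) (A : Matrix (Fin k) (Fin k) ℝ)
  {Ω : Type*} [MeasurableSpace Ω] (P : Measure Ω) (X : Ω → EuclideanSpace ℝ (Fin k))

/-- The random vector of power injections `p = S (A X + μ)`, where `A` is a square root of the
covariance matrix of the first `k` injections. -/
def injection (μ : Fin k → ℝ) (ω : Ω) : Fin (k + 1) → ℝ :=
  slackMatrix k *ᵥ (A *ᵥ (X ω).ofLp + μ)

/-- The line power flows `B L⁺ p`. -/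
def rawFlow (μ : Fin k → ℝ) (ω : Ω) : Fin m → ℝ :=
  (G.inc * G.lapPinv) *ᵥ injection A X μ ω

/-- The normalized line power flows `f = C p`. -/
def flow (μ : Fin k → ℝ) (ω : Ω) : Fin m → ℝ :=
  G.matC *ᵥ injection A X μ ω

/-- The line failure event: some line carries at least its capacity. -/
def failure (μ : Fin k → ℝ) : Set Ω :=
  {ω | ∃ ℓ, G.cap ℓ ≤ |G.rawFlow A X μ ω ℓ|}

/-- The risk level `r(μ)`, the expectation of `max_ℓ |f_ℓ|`. -/
def risk (μ : Fin k → ℝ) : ℝ := ∫ ω, (⨆ ℓ, |G.flow A X μ ω ℓ|) ∂P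

/-- The vector `ν = W μ` of expected normalized flows, `W = C S`. -/
def ν (μ : Fin k → ℝ) : Fin m → ℝ := (G.matC * slackMatrix k) *ᵥ μ

/-- The matrix `V = C S A`, for which `f = V X + W μ`. -/
def matV : Matrix (Fin m) (Fin k) ℝ := G.matC * slackMatrix k * A

/-- The standard deviation `σ_ℓ` of the normalized flow on line `ℓ`. -/
def σ (ℓ : Fin m) : ℝ := √(∑ j, G.matV A ℓ j ^ 2)

/-- `max_ℓ σ_ℓ`. -/
def maxσ : ℝ := ⨆ ℓ, G.σ A ℓ

/-- The upper bound `r⋆(μ)` on the risk level. -/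
def rStar (μ : Fin k → ℝ) : ℝ :=
  ⨅ s : Set.Ioi (0 : ℝ),
    (Real.log (2 * m) / (s : ℝ) + ⨆ ℓ, (G.σ A ℓ ^ 2 / 2 * (s : ℝ) + |G.ν μ ℓ|))

/-- The explicit region. -/
def upRegion (q : ℝ) : Set (Fin k → ℝ) :=
  {μ | (⨆ ℓ, |G.ν μ ℓ|) ≤
    1 - G.maxσ A * (√(2 * Real.log q⁻¹) + √(2 * Real.log (2 * m)))}

/-- The intermediate region, given by `r⋆`. -/
def starRegion (q : ℝ) : Set (Fin k → ℝ) :=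
  {μ | G.rStar A μ ≤ 1 - G.maxσ A * √(2 * Real.log q⁻¹)}

/-- The concentration region. -/
def ciRegion (q : ℝ) : Set (Fin k → ℝ) :=
  {μ | G.risk A P X μ ≤ 1 - G.maxσ A * √(2 * Real.log q⁻¹)}

/-- The true safe region. -/
def trueRegion (q : ℝ) : Set (Fin k → ℝ) :=
  {μ | P.real (G.failure A X μ) ≤ q}

end PowerGrid

end

/-! The largest normalized flow is F(z) = max |⟨v_ℓ, z⟩ + ν_ℓ| at a standard Gaussian z, where v_ℓ
is a row of V and has norm σ_ℓ. It is a maximum of 2m affine functions and is Lipschitz with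
constant `maxσ`, so everything rests on two facts about such maxima.

(a) Concentration: E exp(sF) ≤ exp(s E F + s² maxσ² / 2) (`integral_exp_iSup_affine_le`). By
Chernoff, P(F ≥ 1) ≤ exp(-s(1 - r) + s² maxσ² / 2), which is at most q for a suitable s when r < 1
and maxσ √(2 log q⁻¹) ≤ 1 - r.

(b) Mean: by Jensen, and by bounding the exponential of a maximum by the sum of exponentials, r is
at most each expression in the infimum `rStar` (`integral_iSup_affine_le`). A good choice of s then
bounds `rStar` by max |ν_ℓ| + maxσ √(2 log(2m)).

The sharp constant in (a) comes from averaging in small steps. Let P_t be averaging over a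
displacement t z. For f with Lipschitz constant L and a Lipschitz gradient, a second-order expansion
gives P_t e^f ≤ exp(P_t f + t² L² / 2 + C t³), with C depending only on the two constants, and P_t
preserves both constants. Since P_a P_b = P_c with c² = a² + b², n steps of size 1/√n give P_1 with
total error C/√n, which tends to 0. Maxima are reached by log-sum-exp smoothing. -/

noncomputable section

/-! ### Integrability under the Gaussian measure and the semigroup law of Gaussian averaging. -/

section GaussianConcentration

open scoped RealInnerProductSpace

variable {E : Type*} [NormedAddCommGroup E]

/-- At most exponential growth in the norm. -/
def ExpGrowth (f : E → ℝ) : Prop :=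
  ∃ A B : ℝ, 0 ≤ A ∧ 0 ≤ B ∧ ∀ x, |f x| ≤ A * Real.exp (B * ‖x‖)

namespace ExpGrowth

variable {f g : E → ℝ}

theorem mono (hf : ExpGrowth f) (h : ∀ x, |g x| ≤ |f x|) : ExpGrowth g := by
  obtain ⟨A, B, hA, hB, hf⟩ := hf
  exact ⟨A, B, hA, hB, fun x => (h x).trans (hf x)⟩

theorem const (c : ℝ) : ExpGrowth (fun _ : E => c) :=
  ⟨|c|, 0, abs_nonneg c, le_rfl, fun x => by simp⟩

theorem norm : ExpGrowth (fun x : E => ‖x‖) :=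
  ⟨1, 1, zero_le_one, zero_le_one, fun x => by
    rw [abs_norm, one_mul, one_mul]
    linarith [Real.add_one_le_exp ‖x‖]⟩

theorem exp_norm (c B : ℝ) (hB : 0 ≤ B) :
    ExpGrowth (fun x : E => Real.exp (c + B * ‖x‖)) :=
  ⟨Real.exp c, B, (Real.exp_pos c).le, hB, fun x => by
    rw [abs_of_pos (Real.exp_pos _), Real.exp_add]⟩

theorem add (hf : ExpGrowth f) (hg : ExpGrowth g) : ExpGrowth (fun x => f x + g x) := by
  obtain ⟨A, B, hA, hB, hf⟩ := hf
  obtain ⟨A', B', hA', hB', hg⟩ := hg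
  refine ⟨A + A', max B B', by positivity, by positivity, fun x => ?_⟩
  have h1 : A * Real.exp (B * ‖x‖) ≤ A * Real.exp (max B B' * ‖x‖) := by
    gcongr; exact le_max_left _ _
  have h2 : A' * Real.exp (B' * ‖x‖) ≤ A' * Real.exp (max B B' * ‖x‖) := by
    gcongr; exact le_max_right _ _
  linarith [abs_add_le (f x) (g x), hf x, hg x]

theorem mul (hf : ExpGrowth f) (hg : ExpGrowth g) : ExpGrowth (fun x => f x * g x) := by
  obtain ⟨A, B, hA, hB, hf⟩ := hf
  obtain ⟨A', B', hA', hB', hg⟩ := hg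
  refine ⟨A * A', B + B', by positivity, by positivity, fun x => ?_⟩
  rw [abs_mul, add_mul, Real.exp_add]
  calc |f x| * |g x| ≤ (A * Real.exp (B * ‖x‖)) * (A' * Real.exp (B' * ‖x‖)) := by
        gcongr <;> simp only [hf, hg]
    _ = _ := by ring

theorem pow (hf : ExpGrowth f) (n : ℕ) : ExpGrowth (fun x => f x ^ n) := by
  induction n with
  | zero => simpa using const (E := E) 1
  | succ n ih => simpa only [pow_succ] using ih.mul hf

theorem comp_add_smul [NormedSpace ℝ E] (hf : ExpGrowth f) (x : E) (t : ℝ) :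
    ExpGrowth (fun z => f (x + t • z)) := by
  obtain ⟨A, B, hA, hB, hf⟩ := hf
  refine ⟨A * Real.exp (B * ‖x‖), B * |t|, by positivity, by positivity, fun z => ?_⟩
  refine (hf _).trans ?_
  rw [mul_assoc, ← Real.exp_add]
  gcongr
  have : ‖x + t • z‖ ≤ ‖x‖ + |t| * ‖z‖ := by
    simpa [norm_smul] using norm_add_le x (t • z)
  nlinarith

theorem of_lipschitz {L : ℝ} (hL : 0 ≤ L) (hf : ∀ x y, |f x - f y| ≤ L * ‖x - y‖) :
    ExpGrowth f := by
  have h : ExpGrowth (fun x : E => |f 0| + L * ‖x‖) := (const _).add ((const L).mul norm)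
  refine h.mono fun x => ?_
  rw [abs_of_nonneg (a := |f 0| + L * ‖x‖) (by positivity)]
  have := hf x 0
  rw [sub_zero] at this
  linarith [abs_sub_abs_le_abs_sub (f x) (f 0)]

theorem exp_of_lipschitz {L : ℝ} (hL : 0 ≤ L) (hf : ∀ x y, |f x - f y| ≤ L * ‖x - y‖) :
    ExpGrowth (fun x => Real.exp (f x)) := by
  refine (exp_norm (f 0) L hL).mono fun x => ?_
  rw [abs_of_pos (Real.exp_pos _), abs_of_pos (Real.exp_pos _)]
  gcongr
  have := hf x 0
  rw [sub_zero] at this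
  linarith [le_abs_self (f x - f 0)]

end ExpGrowth

theorem continuous_of_abs_sub_le {f : E → ℝ} {L : ℝ}
    (hf : ∀ x y, |f x - f y| ≤ L * ‖x - y‖) : Continuous f :=
  (LipschitzWith.of_dist_le' (K := L) fun x y => by
    rw [Real.dist_eq, dist_eq_norm]; exact hf x y).continuous

variable [InnerProductSpace ℝ E] [FiniteDimensional ℝ E] [MeasurableSpace E] [BorelSpace E]

/-- Fernique's theorem makes exp(C‖x‖²) integrable for some C > 0, and completing the square gives
B‖x‖ ≤ B²/(4C) + C‖x‖². -/
theorem integrable_exp_norm_stdGaussian (B : ℝ) :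
    Integrable (fun x : E => Real.exp (B * ‖x‖)) (stdGaussian E) := by
  have : CompleteSpace E := FiniteDimensional.complete ℝ E
  obtain ⟨C, hC, h⟩ := IsGaussian.exists_integrable_exp_sq (stdGaussian E)
  refine (h.const_mul (Real.exp (B ^ 2 / (4 * C)))).mono' (by fun_prop) (.of_forall fun x => ?_)
  rw [Real.norm_eq_abs, abs_of_pos (Real.exp_pos _), ← Real.exp_add]
  gcongr
  have : B ^ 2 / (4 * C) + C * ‖x‖ ^ 2 - B * ‖x‖ = (B - 2 * C * ‖x‖) ^ 2 / (4 * C) := by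
    field_simp; ring
  have h2 : 0 ≤ (B - 2 * C * ‖x‖) ^ 2 / (4 * C) := by positivity
  linarith

theorem ExpGrowth.integrable {f : E → ℝ} (hf : ExpGrowth f) (hc : Continuous f) :
    Integrable f (stdGaussian E) := by
  obtain ⟨A, B, -, -, h⟩ := hf
  exact ((integrable_exp_norm_stdGaussian B).const_mul A).mono'
    hc.aestronglyMeasurable (.of_forall h)

/-- Averaging over a Gaussian displacement of scale `t`. -/
def gaussianAvg (t : ℝ) (f : E → ℝ) (x : E) : ℝ := ∫ z, f (x + t • z) ∂stdGaussian E

theorem ExpGrowth.integrable_comp {f : E → ℝ} (hf : ExpGrowth f) (hc : Continuous f)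
    (x : E) (t : ℝ) : Integrable (fun z => f (x + t • z)) (stdGaussian E) :=
  (hf.comp_add_smul x t).integrable (by fun_prop)

theorem stronglyMeasurable_gaussianAvg {f : E → ℝ} (hc : Continuous f) (t : ℝ) :
    StronglyMeasurable (gaussianAvg t f) := by
  refine StronglyMeasurable.integral_prod_right (f := fun x z => f (x + t • z)) ?_
  exact Continuous.stronglyMeasurable (by fun_prop)

theorem stdGaussian_conv_smul (a b : ℝ) :
    (stdGaussian E).map (fun z => a • z) ∗ (stdGaussian E).map (fun z => b • z)
      = (stdGaussian E).map (fun z => √(a ^ 2 + b ^ 2) • z) := by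
  have : CompleteSpace E := FiniteDimensional.complete ℝ E
  have h (r : ℝ) : IsProbabilityMeasure ((stdGaussian E).map (fun z => r • z)) :=
    Measure.isProbabilityMeasure_map (by fun_prop)
  have := h a
  have := h b
  have := h (√(a ^ 2 + b ^ 2))
  refine Measure.ext_of_charFun (funext fun t => ?_)
  rw [charFun_conv, charFun_map_smul, charFun_map_smul, charFun_map_smul, charFun_stdGaussian,
    charFun_stdGaussian, charFun_stdGaussian, ← Complex.exp_add]
  congr 1
  have : ‖√(a ^ 2 + b ^ 2) • t‖ ^ 2 = ‖a • t‖ ^ 2 + ‖b • t‖ ^ 2 := by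
    simp only [norm_smul, mul_pow, Real.norm_eq_abs, sq_abs]
    rw [Real.sq_sqrt (by positivity)]; ring
  rw [← Complex.ofReal_pow (‖√(a ^ 2 + b ^ 2) • t‖), this]
  push_cast
  ring

/-- Independent displacements of scales a and b add up to one whose variance is the sum;
`stdGaussian_conv_smul` reads this off the characteristic functions. -/
theorem gaussianAvg_gaussianAvg {f : E → ℝ} (hf : ExpGrowth f) (hc : Continuous f)
    (a b : ℝ) (x : E) :
    gaussianAvg a (gaussianAvg b f) x = gaussianAvg (√(a ^ 2 + b ^ 2)) f x := by
  have h (r : ℝ) : IsProbabilityMeasure ((stdGaussian E).map (fun z => r • z)) :=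
    Measure.isProbabilityMeasure_map (by fun_prop)
  have := h a
  have := h b
  have hint : Integrable (fun y => f (x + y))
      ((stdGaussian E).map (fun z => a • z) ∗ (stdGaussian E).map (fun z => b • z)) := by
    rw [stdGaussian_conv_smul, integrable_map_measure
      (Continuous.aestronglyMeasurable (by fun_prop)) (by fun_prop)]
    exact hf.integrable_comp hc x _
  have key := integral_conv hint
  rw [stdGaussian_conv_smul, integral_map (by fun_prop)
    (Continuous.aestronglyMeasurable (by fun_prop))] at key
  unfold gaussianAvg
  rw [key]
  have hinner (y : E) : ∫ w, f (x + (y + w)) ∂(stdGaussian E).map (fun z => b • z)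
      = gaussianAvg b f (x + y) := by
    rw [integral_map (by fun_prop) (Continuous.aestronglyMeasurable (by fun_prop))]
    simp only [gaussianAvg, add_assoc]
  simp only [hinner]
  rw [integral_map (by fun_prop)]
  · rfl
  · exact ((stronglyMeasurable_gaussianAvg hc b).comp_measurable
      (measurable_const_add x)).aestronglyMeasurable

end GaussianConcentration

/-! ### Gaussian concentration for smooth functions, by small steps. -/

section GaussianConcentrationStep

open scoped RealInnerProductSpace

variable {E : Type*} [NormedAddCommGroup E] [InnerProductSpace ℝ E]

/-- `f` is `L`-Lipschitz with `K`-Lipschitz gradient `a`. -/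
structure HasLipschitzGrad (L K : ℝ) (f : E → ℝ) (a : E → E) : Prop where
  lip : ∀ x y, |f x - f y| ≤ L * ‖x - y‖
  norm_le : ∀ x, ‖a x‖ ≤ L
  grad_lip : ∀ x y, ‖a x - a y‖ ≤ K * ‖x - y‖
  taylor : ∀ x y, |f (x + y) - f x - ⟪a x, y⟫| ≤ K * ‖y‖ ^ 2

theorem HasLipschitzGrad.const_mul {L K : ℝ} {f : E → ℝ} {a : E → E}
    (h : HasLipschitzGrad L K f a) {r : ℝ} (hr : 0 ≤ r) :
    HasLipschitzGrad (r * L) (r * K) (fun x => r * f x) (fun x => r • a x) where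
  lip x y := by
    rw [← mul_sub, abs_mul, abs_of_nonneg hr, mul_assoc]
    exact mul_le_mul_of_nonneg_left (h.lip x y) hr
  norm_le x := by
    rw [norm_smul, Real.norm_of_nonneg hr]
    exact mul_le_mul_of_nonneg_left (h.norm_le x) hr
  grad_lip x y := by
    rw [← smul_sub, norm_smul, Real.norm_of_nonneg hr, mul_assoc]
    exact mul_le_mul_of_nonneg_left (h.grad_lip x y) hr
  taylor x y := by
    rw [real_inner_smul_left, ← mul_sub, ← mul_sub, abs_mul, abs_of_nonneg hr, mul_assoc]
    exact mul_le_mul_of_nonneg_left (h.taylor x y) hr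

theorem HasLipschitzGrad.continuous {L K : ℝ} {f : E → ℝ} {a : E → E}
    (h : HasLipschitzGrad L K f a) : Continuous f :=
  continuous_of_abs_sub_le h.lip

theorem HasLipschitzGrad.continuous_grad {L K : ℝ} {f : E → ℝ} {a : E → E}
    (h : HasLipschitzGrad L K f a) : Continuous a :=
  (LipschitzWith.of_dist_le' (K := K) fun x y => by
    simp only [dist_eq_norm]; exact h.grad_lip x y).continuous

theorem HasLipschitzGrad.nonneg {L K : ℝ} {f : E → ℝ} {a : E → E}
    (h : HasLipschitzGrad L K f a) : 0 ≤ L := (norm_nonneg _).trans (h.norm_le 0)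

variable [FiniteDimensional ℝ E] [MeasurableSpace E] [BorelSpace E]

/-- All four fields are bounds uniform in the base point, so they survive averaging over translates.
Encoding the gradient by a Taylor bound avoids differentiating under the integral. -/
theorem HasLipschitzGrad.average {L K : ℝ} {f : E → ℝ} {a : E → E}
    (h : HasLipschitzGrad L K f a) (t : ℝ) :
    HasLipschitzGrad L K (gaussianAvg t f) (fun x => ∫ z, a (x + t • z) ∂stdGaussian E) := by
  have : CompleteSpace E := FiniteDimensional.complete ℝ E
  have hf (x : E) : Integrable (fun z => f (x + t • z)) (stdGaussian E) :=
    (ExpGrowth.of_lipschitz h.nonneg h.lip).integrable_comp h.continuous x t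
  have hac := h.continuous_grad
  have ha (x : E) : Integrable (fun z => a (x + t • z)) (stdGaussian E) :=
    (integrable_const L).mono' (Continuous.aestronglyMeasurable (by fun_prop))
      (.of_forall fun z => h.norm_le _)
  refine ⟨fun x y => ?_, fun x => ?_, fun x y => ?_, fun x y => ?_⟩
  · rw [gaussianAvg, gaussianAvg, ← integral_sub (hf x) (hf y)]
    have := norm_integral_le_of_norm_le_const (μ := stdGaussian E)
      (f := fun z => f (x + t • z) - f (y + t • z)) (C := L * ‖x - y‖)
      (.of_forall fun z => by simpa using h.lip (x + t • z) (y + t • z))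
    simpa using this
  · have := norm_integral_le_of_norm_le_const (μ := stdGaussian E)
      (f := fun z => a (x + t • z)) (C := L) (.of_forall fun z => h.norm_le _)
    simpa using this
  · rw [← integral_sub (ha x) (ha y)]
    have := norm_integral_le_of_norm_le_const (μ := stdGaussian E)
      (f := fun z => a (x + t • z) - a (y + t • z)) (C := K * ‖x - y‖)
      (.of_forall fun z => by simpa using h.grad_lip (x + t • z) (y + t • z))
    simpa using this
  · have hin : ⟪∫ z, a (x + t • z) ∂stdGaussian E, y⟫
        = ∫ z, ⟪a (x + t • z), y⟫ ∂stdGaussian E := by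
      rw [real_inner_comm, ← integral_inner (ha x)]
      simp only [real_inner_comm]
    have hd : Integrable (fun z => f (x + y + t • z) - f (x + t • z)) (stdGaussian E) :=
      (hf _).sub (hf _)
    rw [gaussianAvg, gaussianAvg, hin, ← integral_sub (hf _) (hf _),
      ← integral_sub hd ((ha x).inner_const y)]
    have := norm_integral_le_of_norm_le_const (μ := stdGaussian E)
      (f := fun z => f (x + y + t • z) - f (x + t • z) - ⟪a (x + t • z), y⟫)
      (C := K * ‖y‖ ^ 2)
      (.of_forall fun z => by
        have := h.taylor (x + t • z) y
        rwa [show x + t • z + y = x + y + t • z by abel] at this)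
    simpa using this

theorem Real.exp_le_quadratic_add (u : ℝ) :
    Real.exp u ≤ 1 + u + u ^ 2 / 2 + |u| ^ 3 * Real.exp |u| := by
  have := Complex.norm_exp_sub_sum_le_norm_mul_exp (u : ℂ) 3
  simp only [Finset.sum_range_succ, Finset.sum_range_zero] at this
  norm_num [Nat.factorial] at this
  norm_cast at this
  simp only [Real.norm_eq_abs] at this
  have := (abs_le.1 this).2
  linarith

theorem integral_inner_stdGaussian (a : E) : ∫ z, ⟪a, z⟫ ∂stdGaussian E = 0 :=
  integral_strongDual_stdGaussian (innerSL ℝ a)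

theorem integral_inner_sq_stdGaussian (a : E) : ∫ z, ⟪a, z⟫ ^ 2 ∂stdGaussian E = ‖a‖ ^ 2 := by
  have h := variance_dual_stdGaussian (innerSL ℝ a)
  rw [variance_of_integral_eq_zero (by fun_prop) (integral_strongDual_stdGaussian _)] at h
  simpa using h

/-- One small Gaussian step: the local form of the Gaussian concentration inequality. -/
theorem exists_gaussianAvg_exp_le_step {L K : ℝ} (hL : 0 ≤ L) (hK : 0 ≤ K) :
    ∃ C : ℝ, 0 ≤ C ∧ ∀ (f : E → ℝ) (a : E → E), HasLipschitzGrad L K f a →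
      ∀ t : ℝ, 0 ≤ t → t ≤ 1 → ∀ x,
        gaussianAvg t (fun y => Real.exp (f y)) x
          ≤ Real.exp (gaussianAvg t f x + (t ^ 2 * L ^ 2 / 2 + C * t ^ 3)) := by
  set M₁ : ℝ := ∫ z : E, ‖z‖ ∂stdGaussian E with hM₁
  set M₂ : ℝ := ∫ z : E, ‖z‖ ^ 2 ∂stdGaussian E with hM₂
  have hM₁0 : 0 ≤ M₁ := integral_nonneg fun z => norm_nonneg z
  have hM₂0 : 0 ≤ M₂ := integral_nonneg fun z => by positivity
  have i₁ : Integrable (fun z : E => ‖z‖) (stdGaussian E) :=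
    ExpGrowth.norm.integrable continuous_norm
  have i₂ : Integrable (fun z : E => ‖z‖ ^ 2) (stdGaussian E) :=
    (ExpGrowth.norm.pow 2).integrable (by fun_prop)
  -- `H` collects the coefficients of t³: the cross term, the squared Taylor remainder and the cubic
  -- remainder of exp. It involves only L, K and Gaussian moments, so its integral is a constant
  -- valid for every f of the class.
  set H : E → ℝ := fun z => L * K * (‖z‖ * (‖z‖ ^ 2 + M₂)) + K ^ 2 * (‖z‖ ^ 2 + M₂) ^ 2
    + L ^ 3 * ((‖z‖ + M₁) ^ 3 * Real.exp (L * M₁ + L * ‖z‖)) with hH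
  have hH0 (z : E) : 0 ≤ H z := by rw [hH]; positivity
  have gn : ExpGrowth (fun z : E => ‖z‖ ^ 2 + M₂) := (ExpGrowth.norm.pow 2).add (.const _)
  have iH : Integrable H (stdGaussian E) :=
    ((((ExpGrowth.const _).mul (ExpGrowth.norm.mul gn)).add
      ((ExpGrowth.const _).mul (gn.pow 2))).add
      ((ExpGrowth.const _).mul (((ExpGrowth.norm.add (.const _)).pow 3).mul
        (.exp_norm _ _ hL)))).integrable (by fun_prop)
  refine ⟨∫ z, H z ∂stdGaussian E, integral_nonneg hH0, fun f a h t ht0 ht1 x => ?_⟩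
  set m := gaussianAvg t f x with hm
  have fi : Integrable (fun z => f (x + t • z)) (stdGaussian E) :=
    (ExpGrowth.of_lipschitz h.nonneg h.lip).integrable_comp h.continuous x t
  have ini : Integrable (fun z => ⟪a x, z⟫) (stdGaussian E) :=
    IsGaussian.integrable_dual _ (innerSL ℝ (a x))
  have in2i : Integrable (fun z => ⟪a x, z⟫ ^ 2) (stdGaussian E) := by
    refine (i₂.const_mul (‖a x‖ ^ 2)).mono' (by fun_prop) (.of_forall fun z => ?_)
    rw [Real.norm_eq_abs, abs_of_nonneg (by positivity), ← mul_pow, sq_le_sq, abs_mul,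
      abs_norm, abs_norm]
    exact abs_real_inner_le_norm _ _
  have hlip (z : E) : |f (x + t • z) - f x| ≤ t * L * ‖z‖ := by
    have := h.lip (x + t • z) x
    rw [add_sub_cancel_left, norm_smul, Real.norm_of_nonneg ht0] at this
    linarith
  have htay (z : E) : |f (x + t • z) - f x - t * ⟪a x, z⟫| ≤ K * t ^ 2 * ‖z‖ ^ 2 := by
    have := h.taylor x (t • z)
    rw [norm_smul, Real.norm_of_nonneg ht0, real_inner_smul_right] at this
    linarith
  have di : Integrable (fun z => f (x + t • z) - f x) (stdGaussian E) :=
    fi.sub (integrable_const _)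
  have hmf : m - f x = ∫ z, (f (x + t • z) - f x) ∂stdGaussian E := by
    rw [integral_sub fi (integrable_const _)]; simp [hm, gaussianAvg]
  have hm1 : |m - f x| ≤ t * L * M₁ := by
    rw [hmf, hM₁, ← integral_const_mul]
    exact norm_integral_le_of_norm_le (f := fun z => f (x + t • z) - f x)
      (i₁.const_mul (t * L)) (.of_forall hlip)
  -- The linear term has mean zero, so the averaged value differs from f x only at order t².
  have hm2 : |m - f x| ≤ K * t ^ 2 * M₂ := by
    have : m - f x = ∫ z, (f (x + t • z) - f x - t * ⟪a x, z⟫) ∂stdGaussian E := by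
      rw [integral_sub di (ini.const_mul t), ← hmf,
        integral_const_mul, integral_inner_stdGaussian]
      simp
    rw [this, hM₂, ← integral_const_mul]
    exact norm_integral_le_of_norm_le (f := fun z => f (x + t • z) - f x - t * ⟪a x, z⟫)
      (i₂.const_mul (K * t ^ 2)) (.of_forall htay)
  have hpt (z : E) : Real.exp (f (x + t • z) - m)
      ≤ 1 + (f (x + t • z) - m) + t ^ 2 * ⟪a x, z⟫ ^ 2 / 2 + t ^ 3 * H z := by
    set u := f (x + t • z) - m with hu
    have hu1 : |u| ≤ t * (L * (‖z‖ + M₁)) := by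
      have := abs_sub (f (x + t • z) - f x) (m - f x)
      rw [sub_sub_sub_cancel_right] at this
      linarith [hlip z]
    -- With t ≤ 1, the exponential in the cubic remainder is bounded independently of t.
    have hu1' : |u| ≤ L * M₁ + L * ‖z‖ := by
      have : t * (L * (‖z‖ + M₁)) ≤ 1 * (L * (‖z‖ + M₁)) := by gcongr
      linarith
    set R := u - t * ⟪a x, z⟫ with hR
    have hR1 : |R| ≤ t ^ 2 * (K * (‖z‖ ^ 2 + M₂)) := by
      have := abs_sub (f (x + t • z) - f x - t * ⟪a x, z⟫) (m - f x)
      rw [show f (x + t • z) - f x - t * ⟪a x, z⟫ - (m - f x) = R by rw [hR, hu]; ring] at this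
      linarith [htay z]
    have hcross : t * ⟪a x, z⟫ * R ≤ t ^ 3 * (L * K * (‖z‖ * (‖z‖ ^ 2 + M₂))) := by
      refine (le_abs_self _).trans ?_
      rw [abs_mul, abs_mul, abs_of_nonneg ht0]
      have : |⟪a x, z⟫| ≤ L * ‖z‖ :=
        (abs_real_inner_le_norm _ _).trans (by gcongr; exact h.norm_le x)
      calc t * |⟪a x, z⟫| * |R| ≤ t * (L * ‖z‖) * (t ^ 2 * (K * (‖z‖ ^ 2 + M₂))) := by gcongr
        _ = _ := by ring
    have hRsq : R ^ 2 ≤ t ^ 3 * (K ^ 2 * (‖z‖ ^ 2 + M₂) ^ 2) := by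
      rw [← sq_abs]
      calc |R| ^ 2 ≤ (t ^ 2 * (K * (‖z‖ ^ 2 + M₂))) ^ 2 := by gcongr
        _ = t * (t ^ 3 * (K ^ 2 * (‖z‖ ^ 2 + M₂) ^ 2)) := by ring
        _ ≤ 1 * (t ^ 3 * (K ^ 2 * (‖z‖ ^ 2 + M₂) ^ 2)) := by gcongr
        _ = _ := one_mul _
    have hsq : u ^ 2 = t ^ 2 * ⟪a x, z⟫ ^ 2 + 2 * (t * ⟪a x, z⟫ * R) + R ^ 2 := by
      rw [hR]; ring
    have hcub : |u| ^ 3 * Real.exp |u|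
        ≤ t ^ 3 * (L ^ 3 * ((‖z‖ + M₁) ^ 3 * Real.exp (L * M₁ + L * ‖z‖))) := by
      calc |u| ^ 3 * Real.exp |u|
          ≤ (t * (L * (‖z‖ + M₁))) ^ 3 * Real.exp (L * M₁ + L * ‖z‖) := by gcongr
        _ = _ := by ring
    have hpos : 0 ≤ t ^ 3 * (K ^ 2 * (‖z‖ ^ 2 + M₂) ^ 2) := by positivity
    have := Real.exp_le_quadratic_add u
    rw [hsq] at this
    simp only [hH, mul_add (t ^ 3)]
    linarith
  have hint : ∫ z, Real.exp (f (x + t • z) - m) ∂stdGaussian E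
      ≤ 1 + (t ^ 2 * L ^ 2 / 2 + (∫ z, H z ∂stdGaussian E) * t ^ 3) := by
    have dm : Integrable (fun z => f (x + t • z) - m) (stdGaussian E) :=
      fi.sub (integrable_const m)
    have i1 : Integrable (fun z => 1 + (f (x + t • z) - m)) (stdGaussian E) :=
      (integrable_const 1).add dm
    have i2 : Integrable (fun z => t ^ 2 * ⟪a x, z⟫ ^ 2 / 2) (stdGaussian E) :=
      (in2i.const_mul _).div_const 2
    have i3 := iH.const_mul (t ^ 3)
    have := integral_mono_of_nonneg (μ := stdGaussian E)
      (.of_forall fun z => (Real.exp_pos (f (x + t • z) - m)).le)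
      ((i1.add i2).add i3) (.of_forall hpt)
    refine this.trans ?_
    rw [integral_add' (i1.add i2) i3, integral_add' i1 i2,
      integral_add (integrable_const 1) dm,
      integral_sub fi (integrable_const m), integral_div, integral_const_mul, integral_const_mul,
      integral_inner_sq_stdGaussian]
    have hz : ∫ z, f (x + t • z) ∂stdGaussian E = m := rfl
    rw [hz]
    have : t ^ 2 * ‖a x‖ ^ 2 ≤ t ^ 2 * L ^ 2 := by
      gcongr; exact h.norm_le x
    simp
    linarith
  have hfac : gaussianAvg t (fun y => Real.exp (f y)) x
      = Real.exp m * ∫ z, Real.exp (f (x + t • z) - m) ∂stdGaussian E := by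
    rw [← integral_const_mul]
    simp only [← Real.exp_add, add_sub_cancel, gaussianAvg]
  rw [hfac, Real.exp_add]
  gcongr
  refine hint.trans ?_
  rw [add_comm]
  exact Real.add_one_le_exp _

/-- One step is spent on f, and the induction hypothesis is applied to `gaussianAvg t f`, which has
the same constants. Hence the step bound must be uniform over the class, and the errors δ simply
add. -/
theorem gaussianAvg_exp_le_of_step {L K : ℝ} {t δ : ℝ} (ht : 0 ≤ t)
    (hstep : ∀ (f : E → ℝ) (a : E → E), HasLipschitzGrad L K f a → ∀ x,
      gaussianAvg t (fun y => Real.exp (f y)) x ≤ Real.exp (gaussianAvg t f x + δ)) (n : ℕ) :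
    ∀ (f : E → ℝ) (a : E → E), HasLipschitzGrad L K f a → ∀ x,
      gaussianAvg (√n * t) (fun y => Real.exp (f y)) x
        ≤ Real.exp (gaussianAvg (√n * t) f x + n * δ) := by
  induction n with
  | zero => intro f a h x; simp [gaussianAvg]
  | succ n ih =>
    intro f a h x
    have hs : √((n + 1 : ℕ) : ℝ) * t = √((√n * t) ^ 2 + t ^ 2) := by
      rw [mul_pow, Real.sq_sqrt (Nat.cast_nonneg n), ← add_one_mul, Real.sqrt_mul (by positivity),
        Real.sqrt_sq ht]
      push_cast
      rfl
    have he := ExpGrowth.exp_of_lipschitz h.nonneg h.lip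
    have hc := h.continuous
    have hg := h.average t
    have hgc := hg.continuous
    rw [hs, ← gaussianAvg_gaussianAvg he (by fun_prop),
      ← gaussianAvg_gaussianAvg (.of_lipschitz h.nonneg h.lip) hc]
    have hi : Integrable (fun z => Real.exp (gaussianAvg t f (x + (√n * t) • z)))
        (stdGaussian E) :=
      (ExpGrowth.exp_of_lipschitz hg.nonneg hg.lip).integrable_comp (by fun_prop) x _
    calc gaussianAvg (√n * t) (gaussianAvg t fun y => Real.exp (f y)) x
        ≤ gaussianAvg (√n * t) (fun y => Real.exp δ * Real.exp (gaussianAvg t f y)) x := by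
          refine integral_mono_of_nonneg (.of_forall fun z => ?_) (hi.const_mul _)
            (.of_forall fun z => ?_)
          · exact integral_nonneg fun w => (Real.exp_pos _).le
          · refine (hstep f a h _).trans (le_of_eq ?_)
            rw [add_comm, Real.exp_add]
      _ = Real.exp δ * gaussianAvg (√n * t) (fun y => Real.exp (gaussianAvg t f y)) x :=
          integral_const_mul _ _
      _ ≤ Real.exp δ * Real.exp (gaussianAvg (√n * t) (gaussianAvg t f) x + n * δ) := by
          gcongr; exact ih _ _ hg x
      _ = _ := by
          rw [← Real.exp_add]; congr 1; push_cast; ring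

/-- The Gaussian concentration inequality for smooth Lipschitz functions. -/
theorem HasLipschitzGrad.integral_exp_le {L K : ℝ} (hK : 0 ≤ K) {f : E → ℝ} {a : E → E}
    (h : HasLipschitzGrad L K f a) :
    ∫ z, Real.exp (f z) ∂stdGaussian E ≤ Real.exp (∫ z, f z ∂stdGaussian E + L ^ 2 / 2) := by
  obtain ⟨C, hC, hstep⟩ := exists_gaussianAvg_exp_le_step (E := E) h.nonneg hK
  have key (n : ℕ) : ∫ z, Real.exp (f z) ∂stdGaussian E
      ≤ Real.exp (∫ z, f z ∂stdGaussian E + L ^ 2 / 2 + C * (√((n : ℝ) + 1))⁻¹) := by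
    set s := √((n : ℝ) + 1) with hs
    have hs0 : 0 < s := Real.sqrt_pos.2 (by positivity)
    have hs1 : 1 ≤ s := Real.one_le_sqrt.2 (by linarith [(Nat.cast_nonneg n : (0 : ℝ) ≤ n)])
    have hsq : s ^ 2 = n + 1 := Real.sq_sqrt (by positivity)
    -- With n + 1 steps of size 1/√(n + 1), the quadratic terms sum to L²/2 and the cubic ones to
    -- C/√(n + 1).
    have := gaussianAvg_exp_le_of_step (t := s⁻¹) (by positivity)
      (fun f a hf x => hstep f a hf s⁻¹ (by positivity) (inv_le_one_of_one_le₀ hs1) x)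
      (n + 1) f a h 0
    push_cast at this
    rw [← hs, mul_inv_cancel₀ hs0.ne', ← hsq,
      show s ^ 2 * (s⁻¹ ^ 2 * L ^ 2 / 2 + C * s⁻¹ ^ 3) = L ^ 2 / 2 + C * s⁻¹ by
        field_simp] at this
    simpa [gaussianAvg, add_assoc] using this
  have hlim : Filter.Tendsto
      (fun n : ℕ => Real.exp (∫ z, f z ∂stdGaussian E + L ^ 2 / 2 + C * (√((n : ℝ) + 1))⁻¹))
      Filter.atTop (nhds (Real.exp (∫ z, f z ∂stdGaussian E + L ^ 2 / 2 + C * 0))) := by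
    refine (Real.continuous_exp.tendsto _).comp (Filter.Tendsto.const_add _
      (Filter.Tendsto.const_mul _ ?_))
    refine Filter.Tendsto.inv_tendsto_atTop (Real.tendsto_sqrt_atTop.comp ?_)
    exact Filter.tendsto_atTop_add_const_right _ _ tendsto_natCast_atTop_atTop
  simpa using ge_of_tendsto' hlim key

end GaussianConcentrationStep

/-! ### Log-sum-exp smoothing and exponential moments of maxima of affine functions. -/

section GaussianMaximum

open scoped RealInnerProductSpace

variable {E : Type*} [NormedAddCommGroup E] [InnerProductSpace ℝ E]

/-- The Taylor bound is the mean value inequality on the ball of radius ‖y‖ about x, where the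
gradient differs from its value at x by at most K‖y‖. -/
theorem HasLipschitzGrad.of_hasFDerivAt {L K : ℝ} (hK : 0 ≤ K) {f : E → ℝ} {a : E → E}
    (hf : ∀ x, HasFDerivAt f (innerSL ℝ (a x)) x) (ha : ∀ x, ‖a x‖ ≤ L)
    (hlip : ∀ x y, ‖a x - a y‖ ≤ K * ‖x - y‖) : HasLipschitzGrad L K f a where
  lip x y := convex_univ.norm_image_sub_le_of_norm_hasFDerivWithin_le
    (fun z _ => (hf z).hasFDerivWithinAt) (fun z _ => by simpa using ha z)
    (Set.mem_univ y) (Set.mem_univ x)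
  norm_le := ha
  grad_lip := hlip
  taylor x y := by
    have := (convex_closedBall x ‖y‖).norm_image_sub_le_of_norm_hasFDerivWithin_le'
      (φ := innerSL ℝ (a x)) (C := K * ‖y‖) (x := x) (y := x + y)
      (fun z _ => (hf z).hasFDerivWithinAt) (fun z hz => by
        rw [← map_sub, innerSL_apply_norm]
        refine (hlip z x).trans ?_
        gcongr
        simpa [dist_eq_norm] using hz)
      (by simp) (by simp)
    simpa [sq, mul_assoc] using this

variable {ι : Type*} [Fintype ι]

/-- The logarithm of a sum of exponentials of affine functions. -/
def logSumExp (v : ι → E) (c : ι → ℝ) (x : E) : ℝ :=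
  Real.log (∑ i, Real.exp (⟪v i, x⟫ + c i))

/-- The Gibbs weights of the affine functions in `logSumExp`. -/
def gibbsWeight (v : ι → E) (c : ι → ℝ) (i : ι) (x : E) : ℝ :=
  Real.exp (⟪v i, x⟫ + c i - logSumExp v c x)

theorem le_ciSup_of_fintype (g : ι → ℝ) (i : ι) : g i ≤ ⨆ j, g j :=
  le_ciSup (Set.finite_range g).bddAbove i

variable [Nonempty ι]

theorem sum_exp_pos (g : ι → ℝ) : 0 < ∑ i, Real.exp (g i) :=
  Finset.sum_pos (fun _ _ => Real.exp_pos _) Finset.univ_nonempty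

theorem gibbsWeight_eq (v : ι → E) (c : ι → ℝ) (i : ι) (x : E) :
    gibbsWeight v c i x
      = Real.exp (⟪v i, x⟫ + c i) / ∑ j, Real.exp (⟪v j, x⟫ + c j) := by
  rw [gibbsWeight, Real.exp_sub, logSumExp, Real.exp_log (sum_exp_pos _)]

theorem sum_gibbsWeight (v : ι → E) (c : ι → ℝ) (x : E) : ∑ i, gibbsWeight v c i x = 1 := by
  simp only [gibbsWeight_eq, ← Finset.sum_div]
  exact div_self (sum_exp_pos _).ne'

/-- The gradient of log-sum-exp is a convex combination of the v i, so smoothing does not increase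
the Lipschitz constant of the maximum. -/
theorem norm_sum_gibbsWeight_smul_le {v : ι → E} {L : ℝ} (hv : ∀ i, ‖v i‖ ≤ L) (c : ι → ℝ)
    (x : E) : ‖∑ i, gibbsWeight v c i x • v i‖ ≤ L := by
  calc ‖∑ i, gibbsWeight v c i x • v i‖ ≤ ∑ i, gibbsWeight v c i x * L := by
        refine norm_sum_le_of_le _ fun i _ => ?_
        rw [norm_smul, gibbsWeight, Real.norm_of_nonneg (Real.exp_pos _).le]
        gcongr
        exact hv i
    _ = L := by rw [← Finset.sum_mul, sum_gibbsWeight, one_mul]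

theorem hasFDerivAt_affine (w : E) (d : ℝ) (x : E) :
    HasFDerivAt (fun y => ⟪w, y⟫ + d) (innerSL ℝ w) x :=
  ((innerSL ℝ w).hasFDerivAt (x := x)).add_const d

theorem hasFDerivAt_logSumExp (v : ι → E) (c : ι → ℝ) (x : E) :
    HasFDerivAt (logSumExp v c) (innerSL ℝ (∑ i, gibbsWeight v c i x • v i)) x := by
  have h := (HasFDerivAt.fun_sum (u := Finset.univ)
    fun i _ => (hasFDerivAt_affine (v i) (c i) x).exp).log (sum_exp_pos _).ne'
  convert! h using 1
  simp only [map_sum, map_smul, Finset.smul_sum, smul_smul, gibbsWeight_eq]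
  refine Finset.sum_congr rfl fun i _ => ?_
  rw [div_eq_inv_mul]

/-- The gradient of a weight is the weight, at most 1, times the difference of two vectors of norm
at most L. -/
theorem abs_gibbsWeight_sub_le {v : ι → E} {L : ℝ} (hv : ∀ i, ‖v i‖ ≤ L) (c : ι → ℝ)
    (i : ι) (x y : E) :
    |gibbsWeight v c i x - gibbsWeight v c i y| ≤ 2 * L * ‖x - y‖ := by
  refine convex_univ.norm_image_sub_le_of_norm_hasFDerivWithin_le (f := gibbsWeight v c i)
    (fun z _ => (((hasFDerivAt_affine (v i) (c i) z).sub
      (hasFDerivAt_logSumExp v c z)).exp).hasFDerivWithinAt) (fun z _ => ?_)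
    (Set.mem_univ y) (Set.mem_univ x)
  have h1 : gibbsWeight v c i z ≤ 1 := by
    rw [← sum_gibbsWeight v c z]
    exact Finset.single_le_sum (f := fun i => gibbsWeight v c i z)
      (fun j _ => (Real.exp_pos _).le) (Finset.mem_univ i)
  rw [← map_sub, norm_smul, innerSL_apply_norm, Real.norm_of_nonneg (Real.exp_pos _).le]
  refine (mul_le_of_le_one_left (norm_nonneg _) h1).trans ?_
  refine (norm_sub_le _ _).trans ?_
  linarith [hv i, norm_sum_gibbsWeight_smul_le hv c z]

/-- The gradient's Lipschitz constant is crude, which costs nothing: it is absent from the bound of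
`HasLipschitzGrad.integral_exp_le`. -/
theorem hasLipschitzGrad_logSumExp {v : ι → E} {L : ℝ} (hv : ∀ i, ‖v i‖ ≤ L) (c : ι → ℝ) :
    HasLipschitzGrad L (∑ _i : ι, 2 * L * L) (logSumExp v c)
      (fun x => ∑ i, gibbsWeight v c i x • v i) := by
  have hL : 0 ≤ L := (norm_nonneg _).trans (hv (Classical.arbitrary ι))
  refine .of_hasFDerivAt (Finset.sum_nonneg fun _ _ => by positivity)
    (hasFDerivAt_logSumExp v c) (norm_sum_gibbsWeight_smul_le hv c) fun x y => ?_
  rw [← Finset.sum_sub_distrib, Finset.sum_mul]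
  refine norm_sum_le_of_le _ fun i _ => ?_
  rw [← sub_smul, norm_smul]
  calc _ ≤ (2 * L * ‖x - y‖) * L := by
        gcongr
        · exact abs_gibbsWeight_sub_le hv c i x y
        · exact hv i
    _ = _ := by ring

theorem le_log_sum_exp (g : ι → ℝ) : ⨆ i, g i ≤ Real.log (∑ i, Real.exp (g i)) :=
  ciSup_le fun i => (Real.le_log_iff_exp_le (sum_exp_pos _)).2 <|
    Finset.single_le_sum (f := fun i => Real.exp (g i)) (fun _ _ => (Real.exp_pos _).le)
      (Finset.mem_univ i)

theorem log_sum_exp_le {g : ι → ℝ} {b : ℝ} (hb : ∀ i, g i ≤ b) :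
    Real.log (∑ i, Real.exp (g i)) ≤ Real.log (Fintype.card ι) + b := by
  rw [Real.log_le_iff_le_exp (sum_exp_pos _), Real.exp_add,
    Real.exp_log (by exact_mod_cast Fintype.card_pos)]
  calc ∑ i, Real.exp (g i) ≤ ∑ _i : ι, Real.exp b :=
        Finset.sum_le_sum fun i _ => Real.exp_le_exp.2 (hb i)
    _ = _ := by simp

theorem abs_iSup_affine_sub_le {v : ι → E} {L : ℝ} (hv : ∀ i, ‖v i‖ ≤ L) (c : ι → ℝ)
    (x y : E) : |(⨆ i, (⟪v i, x⟫ + c i)) - ⨆ i, (⟪v i, y⟫ + c i)| ≤ L * ‖x - y‖ := by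
  have key (x y : E) : (⨆ i, (⟪v i, x⟫ + c i)) ≤ (⨆ i, (⟪v i, y⟫ + c i)) + L * ‖x - y‖ := by
    refine ciSup_le fun i => ?_
    have h1 := le_ciSup_of_fintype (fun i => ⟪v i, y⟫ + c i) i
    have h2 : ⟪v i, x - y⟫ ≤ L * ‖x - y‖ :=
      (real_inner_le_norm _ _).trans (by gcongr; exact hv i)
    rw [inner_sub_right] at h2
    linarith
  rw [abs_le]
  have := key y x
  rw [norm_sub_rev] at this
  exact ⟨by linarith, by linarith [key x y]⟩

/-- Since |y| = max(y, -y), the sign becomes a Boolean index; this doubling is the source of the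
factor 2 in log(2m). -/
theorem iSup_abs_affine_eq (v : ι → E) (c : ι → ℝ) (x : E) :
    ⨆ i, |⟪v i, x⟫ + c i|
      = ⨆ p : ι × Bool, (⟪bif p.2 then v p.1 else -v p.1, x⟫ + bif p.2 then c p.1 else -c p.1) := by
  apply le_antisymm
  · refine ciSup_le fun i => abs_le'.2 ⟨?_, ?_⟩
    · exact (le_ciSup_of_fintype (fun p : ι × Bool => ⟪bif p.2 then v p.1 else -v p.1, x⟫
        + bif p.2 then c p.1 else -c p.1) (i, true)).trans' (by simp)
    · exact (le_ciSup_of_fintype (fun p : ι × Bool => ⟪bif p.2 then v p.1 else -v p.1, x⟫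
        + bif p.2 then c p.1 else -c p.1) (i, false)).trans' (by simp [inner_neg_left])
  · refine ciSup_le fun p => ?_
    refine le_trans ?_ (le_ciSup_of_fintype (fun i => |⟪v i, x⟫ + c i|) p.1)
    rcases p with ⟨i, _ | _⟩
    · simpa [inner_neg_left, add_comm] using neg_le_abs (⟪v i, x⟫ + c i)
    · simpa using le_abs_self (⟪v i, x⟫ + c i)

variable [FiniteDimensional ℝ E] [MeasurableSpace E] [BorelSpace E]

/-- The Gaussian concentration inequality for a maximum of affine functions. -/
theorem integral_exp_iSup_affine_le {v : ι → E} {L : ℝ} (hv : ∀ i, ‖v i‖ ≤ L) (c : ι → ℝ)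
    {s : ℝ} (hs : 0 ≤ s) :
    ∫ z, Real.exp (s * ⨆ i, (⟪v i, z⟫ + c i)) ∂stdGaussian E
      ≤ Real.exp (s * ∫ z, (⨆ i, (⟪v i, z⟫ + c i)) ∂stdGaussian E + s ^ 2 * L ^ 2 / 2) := by
  have hL : 0 ≤ L := (norm_nonneg _).trans (hv (Classical.arbitrary ι))
  set M : E → ℝ := fun z => ⨆ i, (⟪v i, z⟫ + c i) with hM
  have hMlip := abs_iSup_affine_sub_le hv c
  have hMi : Integrable M (stdGaussian E) :=
    (ExpGrowth.of_lipschitz hL hMlip).integrable (continuous_of_abs_sub_le hMlip)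
  have key (n : ℕ) : ∫ z, Real.exp (s * M z) ∂stdGaussian E
      ≤ Real.exp (s * (∫ z, M z ∂stdGaussian E + Real.log (Fintype.card ι) / ((n : ℝ) + 1))
        + s ^ 2 * L ^ 2 / 2) := by
    -- Here β is an inverse temperature: F/β lies between M and M + log(card ι)/β, while (s/β)F is
    -- still sL-Lipschitz. The error vanishes as β → ∞.
    set β : ℝ := (n : ℝ) + 1 with hβ
    have hβ0 : 0 < β := by positivity
    have hv' (i : ι) : ‖β • v i‖ ≤ β * L := by
      rw [norm_smul, Real.norm_of_nonneg hβ0.le]; gcongr; exact hv i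
    have hF := hasLipschitzGrad_logSumExp hv' (fun i => β * c i)
    set F := logSumExp (fun i => β • v i) (fun i => β * c i) with hFdef
    have hexp (z : E) (i : ι) : ⟪β • v i, z⟫ + β * c i = β * (⟪v i, z⟫ + c i) := by
      rw [real_inner_smul_left]; ring
    have hF1 (z : E) : β * M z ≤ F z := by
      refine le_trans ?_ (le_log_sum_exp _)
      simp only [hexp, hM]
      rw [Real.mul_iSup_of_nonneg hβ0.le]
    have hF2 (z : E) : F z ≤ Real.log (Fintype.card ι) + β * M z := by
      refine log_sum_exp_le fun i => ?_
      rw [hexp]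
      gcongr
      exact le_ciSup_of_fintype (fun i => ⟪v i, z⟫ + c i) i
    have hG := hF.const_mul (r := s / β) (by positivity)
    have hFi : Integrable F (stdGaussian E) :=
      (ExpGrowth.of_lipschitz hF.nonneg hF.lip).integrable hF.continuous
    have hGe : Integrable (fun z => Real.exp (s / β * F z)) (stdGaussian E) :=
      (ExpGrowth.exp_of_lipschitz hG.nonneg hG.lip).integrable
        (by have := hF.continuous; fun_prop)
    have hGI := hG.integral_exp_le (by positivity)
    calc ∫ z, Real.exp (s * M z) ∂stdGaussian E
        ≤ ∫ z, Real.exp (s / β * F z) ∂stdGaussian E := by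
          refine integral_mono_of_nonneg (.of_forall fun z => (Real.exp_pos _).le) hGe
            (.of_forall fun z => Real.exp_le_exp.2 ?_)
          calc s * M z = s / β * (β * M z) := by field_simp
            _ ≤ _ := by gcongr; exact hF1 z
      _ ≤ _ := hGI
      _ ≤ _ := by
          rw [integral_const_mul]
          have hi : ∫ z, F z ∂stdGaussian E
              ≤ Real.log (Fintype.card ι) + β * ∫ z, M z ∂stdGaussian E := by
            have := integral_mono hFi ((integrable_const _).add (hMi.const_mul β)) hF2
            rw [integral_add' (integrable_const _) (hMi.const_mul β), integral_const_mul] at this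
            simpa using this
          refine Real.exp_le_exp.2 ?_
          have h1 : s / β * ∫ z, F z ∂stdGaussian E
              ≤ s / β * (Real.log (Fintype.card ι) + β * ∫ z, M z ∂stdGaussian E) := by gcongr
          have h2 : s / β * (Real.log (Fintype.card ι) + β * ∫ z, M z ∂stdGaussian E)
              = s * (∫ z, M z ∂stdGaussian E + Real.log (Fintype.card ι) / β) := by
            field_simp; ring
          have h3 : (s / β * (β * L)) ^ 2 = s ^ 2 * L ^ 2 := by
            field_simp
          rw [h3]
          linarith
  have hlim : Filter.Tendsto (fun n : ℕ => Real.exp (s * (∫ z, M z ∂stdGaussian E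
        + Real.log (Fintype.card ι) / ((n : ℝ) + 1)) + s ^ 2 * L ^ 2 / 2))
      Filter.atTop
      (nhds (Real.exp (s * (∫ z, M z ∂stdGaussian E + 0) + s ^ 2 * L ^ 2 / 2))) := by
    refine (Real.continuous_exp.tendsto _).comp (Filter.Tendsto.add_const _
      (Filter.Tendsto.const_mul _ (Filter.Tendsto.const_add _ ?_)))
    exact Filter.Tendsto.const_div_atTop
      (Filter.tendsto_atTop_add_const_right _ _ tendsto_natCast_atTop_atTop) _
  simpa using ge_of_tendsto' hlim key

/-- The expected maximum of finitely many affine functions of a Gaussian vector. -/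
theorem integral_iSup_affine_le {v : ι → E} {c : ι → ℝ} {s b : ℝ} (hs : 0 < s)
    (hb : ∀ i, ‖v i‖ ^ 2 / 2 * s + c i ≤ b) :
    ∫ z, (⨆ i, (⟪v i, z⟫ + c i)) ∂stdGaussian E ≤ Real.log (Fintype.card ι) / s + b := by
  obtain ⟨L, hv⟩ : ∃ L, ∀ i, ‖v i‖ ≤ L := ⟨_, le_ciSup_of_fintype fun i => ‖v i‖⟩
  have hL : 0 ≤ L := (norm_nonneg _).trans (hv (Classical.arbitrary ι))
  set M : E → ℝ := fun z => ⨆ i, (⟪v i, z⟫ + c i) with hM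
  have hMlip := abs_iSup_affine_sub_le hv c
  have hMc : Continuous M := continuous_of_abs_sub_le hMlip
  have hsMlip (x y : E) : |s * M x - s * M y| ≤ s * L * ‖x - y‖ := by
    rw [← mul_sub, abs_mul, abs_of_pos hs, mul_assoc]
    exact mul_le_mul_of_nonneg_left (hMlip x y) hs.le
  have hMi : Integrable (fun z => s * M z) (stdGaussian E) :=
    (ExpGrowth.of_lipschitz (by positivity) hsMlip).integrable (by fun_prop)
  have hMe : Integrable (fun z => Real.exp (s * M z)) (stdGaussian E) :=
    (ExpGrowth.exp_of_lipschitz (by positivity) hsMlip).integrable (by fun_prop)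
  -- An affine function has constant gradient, so the concentration inequality itself supplies the
  -- Gaussian moment generating function bound.
  have haff (i : ι) : HasLipschitzGrad (s * ‖v i‖) (s * 0)
      (fun z => s * (⟪v i, z⟫ + c i)) (fun _ => s • v i) :=
    (HasLipschitzGrad.of_hasFDerivAt le_rfl (hasFDerivAt_affine (v i) (c i))
      (fun _ => le_rfl) (by simp)).const_mul hs.le
  have haffe (i : ι) : Integrable (fun z => Real.exp (s * (⟪v i, z⟫ + c i))) (stdGaussian E) :=
    (ExpGrowth.exp_of_lipschitz (haff i).nonneg (haff i).lip).integrable (by fun_prop)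
  have haffI (i : ι) : ∫ z, Real.exp (s * (⟪v i, z⟫ + c i)) ∂stdGaussian E
      ≤ Real.exp (s * b) := by
    refine ((haff i).integral_exp_le (by simp)).trans (Real.exp_le_exp.2 ?_)
    have hin : Integrable (fun z => ⟪v i, z⟫) (stdGaussian E) :=
      IsGaussian.integrable_dual _ (innerSL ℝ (v i))
    rw [integral_const_mul, integral_add hin (integrable_const _), integral_inner_stdGaussian]
    have := mul_le_mul_of_nonneg_left (hb i) hs.le
    simp only [integral_const, probReal_univ, one_smul, zero_add]
    linarith
  have hJ : Real.exp (∫ z, s * M z ∂stdGaussian E) ≤ ∫ z, Real.exp (s * M z) ∂stdGaussian E :=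
    convexOn_exp.map_integral_le Real.continuous_exp.continuousOn isClosed_univ
      (.of_forall fun _ => Set.mem_univ _) hMi hMe
  have hU : ∫ z, Real.exp (s * M z) ∂stdGaussian E ≤ Fintype.card ι * Real.exp (s * b) := by
    calc ∫ z, Real.exp (s * M z) ∂stdGaussian E
        ≤ ∫ z, ∑ i, Real.exp (s * (⟪v i, z⟫ + c i)) ∂stdGaussian E := by
          refine integral_mono hMe (integrable_finsetSum _ fun i _ => haffe i) fun z => ?_
          refine (Real.le_log_iff_exp_le (sum_exp_pos _)).1 ?_
          rw [hM, Real.mul_iSup_of_nonneg hs.le]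
          exact le_log_sum_exp _
      _ = ∑ i, ∫ z, Real.exp (s * (⟪v i, z⟫ + c i)) ∂stdGaussian E :=
          integral_finsetSum _ fun i _ => haffe i
      _ ≤ ∑ _i : ι, Real.exp (s * b) := Finset.sum_le_sum fun i _ => haffI i
      _ = _ := by simp
  have hcard : (0 : ℝ) < Fintype.card ι := by exact_mod_cast Fintype.card_pos
  have h := Real.log_le_log (Real.exp_pos _) (hJ.trans hU)
  rw [Real.log_exp, Real.log_mul hcard.ne' (Real.exp_pos _).ne', Real.log_exp,
    integral_const_mul] at h
  rw [div_add' _ _ _ hs.ne', le_div_iff₀ hs]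
  linarith

end GaussianMaximum

/-! ### Line flows as affine functions of the Gaussian vector. -/

namespace PowerGrid

open scoped RealInnerProductSpace

variable {k m : ℕ} (G : PowerGrid k m) (A : Matrix (Fin k) (Fin k) ℝ)

/-- The row of `matV` of line `ℓ`, as a Euclidean vector. -/
def rowV (ℓ : Fin m) : EuclideanSpace ℝ (Fin k) := WithLp.toLp 2 (G.matV A ℓ)

theorem norm_rowV (ℓ : Fin m) : ‖G.rowV A ℓ‖ = G.σ A ℓ := by
  simp [rowV, EuclideanSpace.norm_eq, σ]

theorem flow_apply {Ω : Type*} (X : Ω → EuclideanSpace ℝ (Fin k)) (μ : Fin k → ℝ) (ω : Ω)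
    (ℓ : Fin m) : G.flow A X μ ω ℓ = ⟪G.rowV A ℓ, X ω⟫ + G.ν μ ℓ := by
  have h : G.flow A X μ ω = G.matV A *ᵥ (X ω).ofLp + G.ν μ := by
    simp only [flow, injection, matV, ν, mulVec_mulVec, mulVec_add, Matrix.mul_assoc]
  rw [h, Pi.add_apply]
  congr 1
  simp [rowV, PiLp.inner_apply, mulVec, dotProduct, mul_comm]

theorem flow_eq_rawFlow_div {Ω : Type*} (X : Ω → EuclideanSpace ℝ (Fin k)) (μ : Fin k → ℝ)
    (ω : Ω) (ℓ : Fin m) : G.flow A X μ ω ℓ = (G.cap ℓ)⁻¹ * G.rawFlow A X μ ω ℓ := by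
  rw [flow, rawFlow, matC, Matrix.mul_assoc, ← mulVec_mulVec, mulVec_diagonal]

theorem σ_nonneg (ℓ : Fin m) : 0 ≤ G.σ A ℓ := Real.sqrt_nonneg _

theorem maxσ_nonneg : 0 ≤ G.maxσ A := Real.iSup_nonneg fun ℓ => G.σ_nonneg A ℓ

theorem σ_le_maxσ (ℓ : Fin m) : G.σ A ℓ ≤ G.maxσ A := le_ciSup_of_fintype (G.σ A) ℓ

/-- The largest absolute normalized flow as a function of the Gaussian vector. -/
def maxFlow (μ : Fin k → ℝ) (z : EuclideanSpace ℝ (Fin k)) : ℝ :=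
  ⨆ ℓ, |⟪G.rowV A ℓ, z⟫ + G.ν μ ℓ|

/-- The directions of the affine functions whose maximum is `maxFlow`. -/
def signedRow (p : Fin m × Bool) : EuclideanSpace ℝ (Fin k) :=
  bif p.2 then G.rowV A p.1 else -G.rowV A p.1

/-- The offsets of the affine functions whose maximum is `maxFlow`. -/
def signedν (μ : Fin k → ℝ) (p : Fin m × Bool) : ℝ :=
  bif p.2 then G.ν μ p.1 else -G.ν μ p.1

theorem norm_signedRow (p : Fin m × Bool) : ‖G.signedRow A p‖ = G.σ A p.1 := by
  rcases p with ⟨ℓ, _ | _⟩ <;> simp [signedRow, norm_rowV]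

theorem signedν_le (μ : Fin k → ℝ) (p : Fin m × Bool) : G.signedν μ p ≤ |G.ν μ p.1| := by
  rcases p with ⟨ℓ, _ | _⟩
  · exact neg_le_abs _
  · exact le_abs_self _

theorem norm_signedRow_le (p : Fin m × Bool) : ‖G.signedRow A p‖ ≤ G.maxσ A :=
  (G.norm_signedRow A p).le.trans (G.σ_le_maxσ A p.1)

/-- Positive `maxσ` makes the safety margin strict. With `maxσ` zero the flows are deterministic,
and risk equal to 1 would mean certain failure. -/
theorem risk_lt_one_of_mem_ciRegion {Ω : Type*} [MeasurableSpace Ω] {P : Measure Ω}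
    {X : Ω → EuclideanSpace ℝ (Fin k)} (hσ : 0 < G.maxσ A) {q : ℝ} (hq0 : 0 < q) (hq1 : q < 1)
    {μ : Fin k → ℝ} (hμ : μ ∈ G.ciRegion A P X q) : G.risk A P X μ < 1 := by
  have hlog : 0 < Real.log q⁻¹ := Real.log_pos ((one_lt_inv₀ hq0).2 hq1)
  have : 0 < G.maxσ A * √(2 * Real.log q⁻¹) := by positivity
  simp only [ciRegion, Set.mem_ofPred_eq] at hμ
  linarith

variable [Nonempty (Fin m)]

theorem maxFlow_eq (μ : Fin k → ℝ) :
    G.maxFlow A μ = fun z => ⨆ p, (⟪G.signedRow A p, z⟫ + G.signedν μ p) :=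
  funext fun z => iSup_abs_affine_eq (G.rowV A) (G.ν μ) z

theorem abs_maxFlow_sub_le (μ : Fin k → ℝ) (x y : EuclideanSpace ℝ (Fin k)) :
    |G.maxFlow A μ x - G.maxFlow A μ y| ≤ G.maxσ A * ‖x - y‖ := by
  rw [maxFlow_eq]
  exact abs_iSup_affine_sub_le (G.norm_signedRow_le A) _ x y

theorem continuous_maxFlow (μ : Fin k → ℝ) : Continuous (G.maxFlow A μ) :=
  continuous_of_abs_sub_le (G.abs_maxFlow_sub_le A μ)

theorem failure_eq {Ω : Type*} {X : Ω → EuclideanSpace ℝ (Fin k)} (μ : Fin k → ℝ) :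
    G.failure A X μ = {ω | 1 ≤ G.maxFlow A μ (X ω)} := by
  have key (ω : Ω) (ℓ : Fin m) : G.cap ℓ ≤ |G.rawFlow A X μ ω ℓ|
      ↔ 1 ≤ |⟪G.rowV A ℓ, X ω⟫ + G.ν μ ℓ| := by
    rw [← flow_apply, flow_eq_rawFlow_div, abs_mul, abs_of_pos (inv_pos.2 (G.cap_pos ℓ)),
      le_inv_mul_iff₀ (G.cap_pos ℓ), mul_one]
  ext ω
  simp only [failure, Set.mem_ofPred_eq, key]
  constructor
  · rintro ⟨ℓ, h⟩
    exact h.trans (le_ciSup_of_fintype (fun ℓ => |⟪G.rowV A ℓ, X ω⟫ + G.ν μ ℓ|) ℓ)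
  · intro h
    obtain ⟨ℓ, hℓ⟩ := exists_eq_ciSup_of_finite (f := fun ℓ => |⟪G.rowV A ℓ, X ω⟫ + G.ν μ ℓ|)
    exact ⟨ℓ, h.trans hℓ.ge⟩

/-! ### Failure probability and upper bounds on the risk. -/

variable {Ω : Type*} [MeasurableSpace Ω] {P : Measure Ω}
  {X : Ω → EuclideanSpace ℝ (Fin k)}

theorem integrable_comp_of_hasLaw (hX : HasLaw X (stdGaussian (EuclideanSpace ℝ (Fin k))) P)
    {f : EuclideanSpace ℝ (Fin k) → ℝ} (hf : ExpGrowth f) (hc : Continuous f) :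
    Integrable (fun ω => f (X ω)) P := by
  have h := hf.integrable hc
  rw [← hX.map_eq] at h
  exact h.comp_aemeasurable hX.aemeasurable

theorem integrable_maxFlow (hX : HasLaw X (stdGaussian (EuclideanSpace ℝ (Fin k))) P)
    (μ : Fin k → ℝ) : Integrable (fun ω => ⨆ ℓ, |G.flow A X μ ω ℓ|) P := by
  simp only [flow_apply]
  exact integrable_comp_of_hasLaw hX
    (.of_lipschitz (G.maxσ_nonneg A) (G.abs_maxFlow_sub_le A μ)) (G.continuous_maxFlow A μ)

theorem risk_eq (hX : HasLaw X (stdGaussian (EuclideanSpace ℝ (Fin k))) P) (μ : Fin k → ℝ) :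
    G.risk A P X μ = ∫ z, G.maxFlow A μ z ∂stdGaussian (EuclideanSpace ℝ (Fin k)) := by
  rw [← hX.integral_comp (G.continuous_maxFlow A μ).aestronglyMeasurable]
  simp only [risk, flow_apply]
  rfl

/-- The Chernoff bound for the line failure probability. -/
theorem failure_le_exp [IsProbabilityMeasure P]
    (hX : HasLaw X (stdGaussian (EuclideanSpace ℝ (Fin k))) P)
    (μ : Fin k → ℝ) {s : ℝ} (hs : 0 ≤ s) :
    P.real (G.failure A X μ)
      ≤ Real.exp (-s * (1 - G.risk A P X μ) + s ^ 2 * G.maxσ A ^ 2 / 2) := by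
  have hc := G.continuous_maxFlow A μ
  have hlip (x y : EuclideanSpace ℝ (Fin k)) :
      |s * G.maxFlow A μ x - s * G.maxFlow A μ y| ≤ s * G.maxσ A * ‖x - y‖ := by
    rw [← mul_sub, abs_mul, abs_of_nonneg hs, mul_assoc]
    exact mul_le_mul_of_nonneg_left (G.abs_maxFlow_sub_le A μ x y) hs
  have hint : Integrable (fun ω => Real.exp (s * G.maxFlow A μ (X ω))) P :=
    integrable_comp_of_hasLaw hX
      (.exp_of_lipschitz (mul_nonneg hs (G.maxσ_nonneg A)) hlip) (by fun_prop)
  have hmgf : mgf (fun ω => G.maxFlow A μ (X ω)) P s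
      ≤ Real.exp (s * G.risk A P X μ + s ^ 2 * G.maxσ A ^ 2 / 2) := by
    have h := hX.integral_comp (f := fun z => Real.exp (s * G.maxFlow A μ z))
      (Continuous.aestronglyMeasurable (by fun_prop))
    have h2 := integral_exp_iSup_affine_le (G.norm_signedRow_le A) (G.signedν μ) hs
    rw [G.risk_eq A hX, mgf]
    refine h.le.trans ?_
    simpa only [maxFlow_eq] using h2
  rw [failure_eq]
  refine (measure_ge_le_exp_mul_mgf 1 hs hint).trans ?_
  refine (mul_le_mul_of_nonneg_left hmgf (Real.exp_pos _).le).trans (le_of_eq ?_)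
  rw [← Real.exp_add]
  congr 1
  ring

theorem risk_le (hX : HasLaw X (stdGaussian (EuclideanSpace ℝ (Fin k))) P) (μ : Fin k → ℝ)
    {s : ℝ} (hs : 0 < s) :
    G.risk A P X μ
      ≤ Real.log (2 * m) / s + ⨆ ℓ, (G.σ A ℓ ^ 2 / 2 * s + |G.ν μ ℓ|) := by
  have h := integral_iSup_affine_le (v := G.signedRow A) (c := G.signedν μ) hs
    (b := ⨆ ℓ, (G.σ A ℓ ^ 2 / 2 * s + |G.ν μ ℓ|)) fun p => by
      rw [norm_signedRow]
      refine le_trans ?_ (le_ciSup_of_fintype (fun ℓ => G.σ A ℓ ^ 2 / 2 * s + |G.ν μ ℓ|) p.1)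
      gcongr
      exact G.signedν_le μ p
  rw [G.risk_eq A hX, maxFlow_eq]
  simpa [mul_comm] using h

theorem risk_le_rStar (hX : HasLaw X (stdGaussian (EuclideanSpace ℝ (Fin k))) P)
    (μ : Fin k → ℝ) : G.risk A P X μ ≤ G.rStar A μ :=
  le_ciInf fun s => G.risk_le A hX μ s.2

theorem log_two_mul_pos : 0 < Real.log (2 * m) := by
  have : 0 < m := Fin.pos (Classical.arbitrary (Fin m))
  exact Real.log_pos (by exact_mod_cast (by omega : 1 < 2 * m))

theorem rStar_le (μ : Fin k → ℝ) {s : ℝ} (hs : 0 < s) :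
    G.rStar A μ ≤ Real.log (2 * m) / s + G.maxσ A ^ 2 / 2 * s + ⨆ ℓ, |G.ν μ ℓ| := by
  have hl := log_two_mul_pos (m := m)
  -- All terms are nonnegative, so the infimum is genuine and not the default value for an unbounded
  -- family.
  have hbdd : BddBelow (Set.range fun s : Set.Ioi (0 : ℝ) =>
      Real.log (2 * m) / (s : ℝ) + ⨆ ℓ, (G.σ A ℓ ^ 2 / 2 * (s : ℝ) + |G.ν μ ℓ|)) := by
    refine ⟨0, ?_⟩
    rintro _ ⟨s, rfl⟩
    have hs : (0 : ℝ) < s := s.2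
    exact add_nonneg (div_nonneg hl.le hs.le) (Real.iSup_nonneg fun ℓ => by positivity)
  refine (ciInf_le hbdd ⟨s, hs⟩).trans ?_
  rw [add_assoc]
  refine add_le_add le_rfl (ciSup_le fun ℓ => ?_)
  gcongr
  · exact G.σ_nonneg A ℓ
  · exact G.σ_le_maxσ A ℓ
  · exact le_ciSup_of_fintype (fun ℓ => |G.ν μ ℓ|) ℓ

/-- The choice s = √(2 log(2m)) / maxσ balances log(2m)/s against maxσ² s / 2. If `maxσ` is zero
there is no optimal s, and s = log(2m)/ε with ε arbitrary replaces it. -/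
theorem rStar_le_explicit (μ : Fin k → ℝ) :
    G.rStar A μ ≤ (⨆ ℓ, |G.ν μ ℓ|) + G.maxσ A * √(2 * Real.log (2 * m)) := by
  have hl := log_two_mul_pos (m := m)
  rcases (G.maxσ_nonneg A).eq_or_lt with h0 | h0
  · rw [← h0, zero_mul, add_zero]
    refine le_of_forall_pos_le_add fun ε hε => ?_
    have := G.rStar_le A μ (div_pos hl hε)
    rw [← h0, div_div_cancel₀ hl.ne'] at this
    linarith
  · set w := √(2 * Real.log (2 * m)) with hw
    have hw0 : 0 < w := Real.sqrt_pos.2 (by positivity)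
    have hw2 : w ^ 2 = 2 * Real.log (2 * m) := Real.sq_sqrt (by positivity)
    refine (G.rStar_le A μ (div_pos hw0 h0)).trans (le_of_eq ?_)
    rw [show Real.log (2 * m) = w ^ 2 / 2 by linarith]
    field_simp
    ring

/-! ### Comparison of the capacity regions. -/

theorem upRegion_subset_starRegion (q : ℝ) : G.upRegion A q ⊆ G.starRegion A q := by
  intro μ hμ
  simp only [upRegion, Set.mem_ofPred_eq] at hμ
  simp only [starRegion, Set.mem_ofPred_eq]
  linarith [G.rStar_le_explicit A μ]

theorem ciRegion_inter_subset_trueRegion [IsProbabilityMeasure P]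
    (hX : HasLaw X (stdGaussian (EuclideanSpace ℝ (Fin k))) P) {q : ℝ} (hq0 : 0 < q)
    (hq1 : q < 1) :
    G.ciRegion A P X q ∩ {μ | G.risk A P X μ < 1} ⊆ G.trueRegion A P X q := by
  rintro μ ⟨hμ, hr⟩
  simp only [ciRegion, Set.mem_ofPred_eq] at hμ hr
  have hlog : 0 < Real.log q⁻¹ := Real.log_pos ((one_lt_inv₀ hq0).2 hq1)
  set w := √(2 * Real.log q⁻¹) with hw
  have hw2 : w ^ 2 = 2 * Real.log q⁻¹ := Real.sq_sqrt (by positivity)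
  set d := 1 - G.risk A P X μ with hd
  have hd0 : 0 < d := by linarith
  have hσw : (G.maxσ A * w) ^ 2 ≤ d ^ 2 :=
    pow_le_pow_left₀ (mul_nonneg (G.maxσ_nonneg A) (Real.sqrt_nonneg _)) (by linarith) 2
  -- The Chernoff optimum d / maxσ² is undefined when `maxσ` is zero. The choice w²/d always works:
  -- since maxσ w ≤ d, the exponent is at most -w² + w²/2 = log q.
  refine (G.failure_le_exp A hX μ (s := w ^ 2 / d) (by positivity)).trans ?_
  rw [← Real.le_log_iff_exp_le hq0, ← hd]
  have h1 : (w ^ 2 / d) ^ 2 * G.maxσ A ^ 2 / 2 ≤ w ^ 2 / 2 := by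
    have : (w ^ 2 / d) ^ 2 * G.maxσ A ^ 2 = w ^ 2 * ((G.maxσ A * w) ^ 2 / d ^ 2) := by
      field_simp
    rw [this]
    have : (G.maxσ A * w) ^ 2 / d ^ 2 ≤ 1 := (div_le_one (by positivity)).2 hσw
    have := mul_le_mul_of_nonneg_left this (sq_nonneg w)
    linarith
  have h2 : -(w ^ 2 / d) * d = -w ^ 2 := by field_simp
  rw [Real.log_inv] at hw2
  linarith

theorem iSup_σ_sq : ⨆ ℓ, G.σ A ℓ ^ 2 = G.maxσ A ^ 2 :=
  (Real.iSup_pow (G.σ_nonneg A) 2).symm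

theorem ciRegion_eq (hσ : 0 < G.maxσ A) {q : ℝ} (hq0 : 0 < q) (hq1 : q < 1) :
    G.ciRegion A P X q = {μ | G.risk A P X μ < 1 ∧
      Real.exp (-(1 - G.risk A P X μ) ^ 2 / (2 * ⨆ ℓ, G.σ A ℓ ^ 2)) ≤ q} := by
  have hlog : 0 < Real.log q⁻¹ := Real.log_pos ((one_lt_inv₀ hq0).2 hq1)
  have hw2 : √(2 * Real.log q⁻¹) ^ 2 = 2 * Real.log q⁻¹ := Real.sq_sqrt (by positivity)
  ext μ
  have key (hr : G.risk A P X μ < 1) :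
      μ ∈ G.ciRegion A P X q ↔
        Real.exp (-(1 - G.risk A P X μ) ^ 2 / (2 * ⨆ ℓ, G.σ A ℓ ^ 2)) ≤ q := by
    rw [← Real.le_log_iff_exp_le hq0, iSup_σ_sq, div_le_iff₀ (by positivity)]
    simp only [ciRegion, Set.mem_ofPred_eq]
    -- Squaring is reversible only because r < 1 makes 1 - r nonnegative; this is why r < 1 appears
    -- separately in the description of the region.
    rw [le_sub_comm, ← sq_le_sq₀ (by positivity) (by linarith), mul_pow, hw2, Real.log_inv]
    constructor <;> intro h <;> linarith
  exact ⟨fun h => have hr := G.risk_lt_one_of_mem_ciRegion A hσ hq0 hq1 h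
    ⟨hr, (key hr).1 h⟩, fun h => (key h.1).2 h.2⟩

end PowerGrid

end

theorem theorem2 {k m : ℕ} (G : PowerGrid k m) (hm : 0 < m)
    (Sig : Matrix (Fin k) (Fin k) ℝ) (hSig : Sig.PosSemidef)
    (A : Matrix (Fin k) (Fin k) ℝ) (hA : A * Aᵀ = Sig)
    {Ω : Type*} [MeasurableSpace Ω] (P : Measure Ω) [IsProbabilityMeasure P]
    (X : Ω → EuclideanSpace ℝ (Fin k))
    (hX : HasLaw X (stdGaussian (EuclideanSpace ℝ (Fin k))) P)
    (q : ℝ) (hq0 : 0 < q) (hq1 : q < 1) :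
    (∀ μ, Integrable (fun ω => ⨆ ℓ, |G.flow A X μ ω ℓ|) P) ∧
    G.upRegion A q ⊆ G.starRegion A q ∧
    G.starRegion A q ⊆ G.ciRegion A P X q ∧
    G.ciRegion A P X q ∩ {μ | G.risk A P X μ < 1} ⊆ G.trueRegion A P X q ∧
    (0 < G.maxσ A →
      G.ciRegion A P X q ⊆ G.trueRegion A P X q ∧
      G.ciRegion A P X q =
        {μ | G.risk A P X μ < 1 ∧
          Real.exp (-(1 - G.risk A P X μ) ^ 2 / (2 * ⨆ ℓ, G.σ A ℓ ^ 2)) ≤ q}) := by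
  have : Nonempty (Fin m) := ⟨⟨0, hm⟩⟩
  have htrue := G.ciRegion_inter_subset_trueRegion A hX hq0 hq1
  refine ⟨G.integrable_maxFlow A hX, G.upRegion_subset_starRegion A q,
    fun μ hμ => (G.risk_le_rStar A hX μ).trans hμ, htrue, fun hσ => ⟨fun μ hμ => ?_, ?_⟩⟩
  · exact htrue ⟨hμ, G.risk_lt_one_of_mem_ciRegion A hσ hq0 hq1 hμ⟩
  · exact G.ciRegion_eq A hσ hq0 hq1
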